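/- Let $n\ge 2$, let $T$ be a commutative domain in which $2$ is invertible, and let $a_{ij}\in T$ for $1\le i\ne j\le n$ with $a_{ij}=a_{ji}$. Let $V_n(\mathcal A)$ be the $T$-algebra generated by $x_1,\dots,x_n$ subject to the relations $x_ix_j+x_jx_i=a_{ij}$ for all $i\neq j$, and let $Z=T[x_1^2,\dots,x_n^2]$ be its (central) subalgebra generated by $x_1^2,\dots,x_n^2$. Then $V_n(\mathcal A)$ is a finitely generated free $Z$-module, and its discriminant over $Z$ is $$d(V_n(\mathcal A)/Z)=c\,(\det M_1)^{2^{n-1}}\quad\text{for some } c\in T^\times,$$ where $M_1$ is the symmetric $n\times n$ matrix over $Z$ with diagonal entries $2x_1^2,\dots,2x_n^2$ and off-diagonal entries $a_{ij}$. Here $d(V_n(\mathcal A)/Z)=\det(\operatorname{tr}(z_iz_j))_{i,j}$ for an arbitrary finite $Z$-basis $(z_i)$ of $V_n(\mathcal A)$, where $\operatorname{tr}(u)\in Z$ is the trace of left multiplication by $u$ on the free $Z$-module $V_n(\mathcal A)$; the formula holds for every choice of basis, with $c$ depending on the basis. In particular, let $W_n$ be the $(-1)$-quantum Weyl algebra over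 $T$, generated by $x_1,\dots,x_n$ subject to $x_ix_j+x_jx_i=1$ for all $i\ne j$. Then $W_n$ is a finitely generated free module over $Z=T[x_1^2,\dots,x_n^2]$, and $d(W_n/Z)=c\,(\det M)^{2^{n-1}}$ for some $c\in T^\times$, where $M$ has diagonal entries $2x_1^2,\dots,2x_n^2$ and all off-diagonal entries equal to $1$. -/

import Mathlib

/-- The discriminant of an algebra `A` over a commutative ring `Z` with respect to a finite
`Z`-basis `b` of `A`: the determinant of the matrix of the traces `tr (b i * b j)`. Here
`tr a` is the trace of left multiplication by `a`, as a `Z`-linear endomorphism of `A`, and `A` need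
not be commutative. -/
noncomputable def discriminant {Z A ι : Type*} [CommRing Z] [Ring A] [Algebra Z A]
    [Fintype ι] [DecidableEq ι] (b : Module.Basis ι Z A) : Z :=
  Matrix.det (Matrix.of fun i j => LinearMap.trace Z A (LinearMap.mulLeft Z (b i * b j)))

namespace VAlg

variable {T : Type*} [CommRing T] {n : ℕ}

/-- The defining relations `x i * x j + x j * x i = a i j` for `i ≠ j`. -/
inductive Rel (a : Fin n → Fin n → T) : FreeAlgebra T (Fin n) → FreeAlgebra T (Fin n) → Prop
  | anticomm (i j : Fin n) (h : i ≠ j) :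
      Rel a (FreeAlgebra.ι T i * FreeAlgebra.ι T j + FreeAlgebra.ι T j * FreeAlgebra.ι T i)
        (algebraMap T (FreeAlgebra T (Fin n)) (a i j))

end VAlg

/-- The `T`-algebra generated by `x 0, …, x (n - 1)` subject to the relations
`x i * x j + x j * x i = a i j` for `i ≠ j`. (The diagonal values `a i i` are not used.) -/
def VAlg {T : Type*} [CommRing T] {n : ℕ} (a : Fin n → Fin n → T) : Type _ :=
  RingQuot (VAlg.Rel a)

namespace VAlg

variable {T : Type*} [CommRing T] {n : ℕ} (a : Fin n → Fin n → T)

noncomputable instance : Ring (VAlg a) := inferInstanceAs (Ring (RingQuot (Rel a)))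

noncomputable instance : Algebra T (VAlg a) := inferInstanceAs (Algebra T (RingQuot (Rel a)))

/-- The generators. -/
noncomputable def x (i : Fin n) : VAlg a :=
  RingQuot.mkAlgHom T (Rel a) (FreeAlgebra.ι T i)

theorem x_mul_x_add (i j : Fin n) (h : i ≠ j) :
    x a i * x a j + x a j * x a i = algebraMap T (VAlg a) (a i j) := by
  have := RingQuot.mkAlgHom_rel T (Rel.anticomm (a := a) i j h)
  rw [map_add, map_mul, map_mul, AlgHom.commutes] at this
  exact this

/-- The subalgebra `T[x 0 ^ 2, …, x (n - 1) ^ 2]` generated by the squares of the generators. -/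
noncomputable def Z : Subalgebra T (VAlg a) :=
  Algebra.adjoin T (Set.range fun i => x a i ^ 2)

theorem commute_sq (i j : Fin n) : x a i ^ 2 * x a j = x a j * x a i ^ 2 := by
  by_cases h : i = j
  · subst h; rw [← pow_succ, ← pow_succ']
  · have h1 := x_mul_x_add a i j h
    have hc := Algebra.commutes (a i j) (x a i)
    rw [← h1] at hc
    rw [add_mul, mul_add] at hc
    have h2 : x a i * x a j * x a i = x a i * (x a j * x a i) := mul_assoc _ _ _
    rw [h2, add_comm] at hc
    have := add_right_cancel hc
    rw [sq, mul_assoc, ← this, mul_assoc]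

theorem mem_center_of_commute_x (z : VAlg a) (hz : ∀ i, z * x a i = x a i * z) :
    z ∈ Subalgebra.center T (VAlg a) := by
  rw [Subalgebra.mem_center_iff]
  intro b
  obtain ⟨f, rfl⟩ := RingQuot.mkAlgHom_surjective T (Rel a) b
  induction f using FreeAlgebra.induction with
  | grade0 r =>
    rw [AlgHom.commutes]
    exact Algebra.commutes r z
  | grade1 i => exact (hz i).symm
  | mul f g hf hg =>
    rw [map_mul]
    exact (show Commute (RingQuot.mkAlgHom T (Rel a) f : VAlg a) z from hf).mul_left hg
  | add f g hf hg =>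
    rw [map_add]
    exact (show Commute (RingQuot.mkAlgHom T (Rel a) f : VAlg a) z from hf).add_left hg

theorem Z_le_center : Z a ≤ Subalgebra.center T (VAlg a) := by
  refine Algebra.adjoin_le ?_
  rintro _ ⟨i, rfl⟩
  exact mem_center_of_commute_x a _ fun j => commute_sq a i j

/-- `Z` is a commutative ring, with the operations of the ambient algebra. -/
noncomputable instance : CommRing (Z a) :=
  { (inferInstance : Ring (Z a)) with
    mul_comm := fun u v => Subtype.ext
      (Subalgebra.mem_center_iff.1 (Z_le_center a v.2) u.1) }

/-- The ambient algebra is an algebra over its central subalgebra `Z`, acting by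
multiplication. -/
noncomputable instance : Algebra (Z a) (VAlg a) where
  smul := fun z v => z • v
  algebraMap := (Z a).val.toRingHom
  commutes' := fun z v => (Subalgebra.mem_center_iff.1 (Z_le_center a z.2) v).symm
  smul_def' := fun _ _ => rfl

/-- The square `x i ^ 2` of a generator, as an element of `Z`. -/
noncomputable def xSq (i : Fin n) : Z a :=
  ⟨x a i ^ 2, Algebra.subset_adjoin ⟨i, rfl⟩⟩

/-- The `n × n` matrix over `Z` with diagonal entries `2 * x i ^ 2` and off-diagonal
entries `a i j`. -/
noncomputable def M₁ : Matrix (Fin n) (Fin n) (Z a) :=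
  Matrix.of fun i j => if i = j then 2 * xSq a i else algebraMap T (Z a) (a i j)

end VAlg

/-- The `(-1)`-quantum Weyl algebra: generators `x i` with relations
`x i * x j + x j * x i = 1` for `i ≠ j`. -/
abbrev WAlg (T : Type*) [CommRing T] (n : ℕ) : Type _ :=
  VAlg (fun _ _ : Fin n => (1 : T))

/-- The subalgebra of the `(-1)`-quantum Weyl algebra generated by the squares of its
generators. -/
noncomputable abbrev WAlg.Z (T : Type*) [CommRing T] (n : ℕ) : Subalgebra T (WAlg T n) :=
  VAlg.Z (fun _ _ : Fin n => (1 : T))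

/-- The matrix with diagonal entries `2 * x i ^ 2` and all off-diagonal entries `1`. -/
noncomputable def WAlg.M (T : Type*) [CommRing T] (n : ℕ) :
    Matrix (Fin n) (Fin n) (WAlg.Z T n) :=
  Matrix.of fun i j => if i = j then 2 * VAlg.xSq _ i else 1

/-!
Over the polynomial ring `P = T[X 0, …, X (n - 1)]`, consider the quadratic form with values `X i`
on the standard basis and polar form `a i j`. The algebra `VAlg a` maps to its Clifford algebra,
with `x i ^ 2` going to `X i`. Since `2` is invertible, the Clifford algebra is isomorphic as a
module to the exterior algebra, hence free of rank `2 ^ n`; the `2 ^ n` ordered monomials span it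
by the commutation relations, so they form a basis. Consequently `Z` is isomorphic to `P`
(`VAlg.polyEquiv`) and the ordered monomials in the `x i` form a basis of `VAlg a` over `Z`
(`VAlg.monomialBasis`). In particular the units of `Z` are those of `T`, so that it suffices to
compute the discriminant of this one basis up to units of `Z`.

The trace functional `τ` of left multiplications satisfies `τ (u * v) = τ (v * u)`, is invariant
under the automorphism `x i ↦ -x i`, and takes the unit value `2 ^ n` at `1`. These properties
determine the Gram determinant `G k` of the ordered monomials in the first `k` generators
(`det_gramMatrix_orderedMonomial`), by induction on `k`. Let `D k` be the leading principal minors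
of `M₁`. The last column of the adjugate of the leading block of size `k + 1` gives a combination
`f = D k • x k + …` of the first `k + 1` generators which anticommutes with `x j` for `j < k` and
satisfies `2 * f ^ 2 = D k * D (k + 1)`. A monomial in the first `k` generators commutes or
anticommutes with `f`, so `τ` vanishes on the products of such a monomial with `f`
(`map_mul_eq_zero`). Hence, if `x k` is replaced by `f`, the Gram matrix becomes block diagonal,
both blocks being the previous Gram matrix, up to the factor `f ^ 2` and signs in the second. This
gives `(D k) ^ (2 * 2 ^ k) * G (k + 1) = ± (D k * D (k + 1) / 2) ^ 2 ^ k * G k ^ 2`, and the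
factors `D k` cancel: they are nonzero, since the diagonal entries of `M₁` are the independent
variables `2 * x i ^ 2` (`VAlg.leadingMinor_mSeq_ne_zero`). The result is
`G n = c * D n ^ 2 ^ (n - 1)` with a unit `c`.
-/

open Matrix

/-! ### Ordered monomials -/

/-- The index set of the `2 ^ k` ordered monomials in `k` generators: a monomial in `k + 1`
generators is a monomial in the first `k` of them (`Sum.inl`), possibly times the last one
(`Sum.inr`). -/
def MonomialIndex : ℕ → Type
  | 0 => Unit
  | k + 1 => MonomialIndex k ⊕ MonomialIndex k

namespace MonomialIndex

instance : ∀ k, Fintype (MonomialIndex k)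
  | 0 => inferInstanceAs (Fintype Unit)
  | k + 1 =>
    letI := instFintype k
    inferInstanceAs (Fintype (MonomialIndex k ⊕ MonomialIndex k))

instance : ∀ k, DecidableEq (MonomialIndex k)
  | 0 => inferInstanceAs (DecidableEq Unit)
  | k + 1 =>
    letI := instDecidableEq k
    inferInstanceAs (DecidableEq (MonomialIndex k ⊕ MonomialIndex k))

theorem card (k : ℕ) : Fintype.card (MonomialIndex k) = 2 ^ k := by
  induction k with
  | zero => rfl
  | succ k ih =>
    rw [show Fintype.card (MonomialIndex (k + 1))
      = Fintype.card (MonomialIndex k ⊕ MonomialIndex k) from rfl, Fintype.card_sum, ih, pow_succ,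
      mul_two]

/-- The sign `(-1) ^ d`, where `d` is the degree of the ordered monomial. -/
def sign : ∀ {k : ℕ}, MonomialIndex k → ℤˣ
  | 0, _ => 1
  | _ + 1, .inl s => sign s
  | _ + 1, .inr s => -sign s

end MonomialIndex

section Ordered

variable {R A : Type*} [CommRing R] [Ring A] [Algebra R A]

/-- The product of the elements of `e 0, …, e (k - 1)` selected by `s`, in increasing order of
the indices. -/
def orderedMonomial (e : ℕ → A) : ∀ {k : ℕ}, MonomialIndex k → A
  | 0, _ => 1
  | _ + 1, .inl s => orderedMonomial e s
  | k + 1, .inr s => orderedMonomial e s * e k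

variable (R) in
/-- The span of the ordered monomials in `e 0, …, e (k - 1)`. -/
def monomialSpan (e : ℕ → A) (k : ℕ) : Submodule R A :=
  Submodule.span R (Set.range (orderedMonomial e : MonomialIndex k → A))

theorem monomialSpan_mono (e : ℕ → A) (k : ℕ) : monomialSpan R e k ≤ monomialSpan R e (k + 1) := by
  refine Submodule.span_le.2 ?_
  rintro _ ⟨s, rfl⟩
  exact Submodule.subset_span ⟨.inl s, rfl⟩

theorem mul_mem_monomialSpan_succ (e : ℕ → A) {k : ℕ} {u : A} (hu : u ∈ monomialSpan R e k) :
    u * e k ∈ monomialSpan R e (k + 1) := by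
  induction hu using Submodule.span_induction with
  | mem u h => obtain ⟨s, rfl⟩ := h; exact Submodule.subset_span ⟨.inr s, rfl⟩
  | zero => simp
  | add u v _ _ hu hv => rw [add_mul]; exact add_mem hu hv
  | smul r u _ hu => rw [smul_mul_assoc]; exact Submodule.smul_mem _ _ hu

theorem one_mem_monomialSpan (e : ℕ → A) (k : ℕ) : 1 ∈ monomialSpan R e k := by
  induction k with
  | zero => exact Submodule.subset_span ⟨(), rfl⟩
  | succ k ih => exact monomialSpan_mono e k ih

theorem map_orderedMonomial {B F : Type*} [Ring B] [FunLike F A B] [MonoidHomClass F A B] (f : F)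
    (e : ℕ → A) {k : ℕ} (s : MonomialIndex k) :
    f (orderedMonomial e s) = orderedMonomial (fun i => f (e i)) s := by
  induction k with
  | zero => exact map_one f
  | succ k ih =>
    cases s with
    | inl s => exact ih s
    | inr s => exact (map_mul f _ _).trans (congrArg (· * f (e k)) (ih s))

/-- An element anticommuting with the generators of a monomial commutes with the monomial up to
the sign of its degree. -/
theorem mul_orderedMonomial (e : ℕ → A) (f : A) {k : ℕ}
    (hf : ∀ j < k, f * e j = -(e j * f)) (s : MonomialIndex k) :
    f * orderedMonomial e s = (s.sign : ℤ) • (orderedMonomial e s * f) := by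
  induction k with
  | zero => simp [orderedMonomial, MonomialIndex.sign]
  | succ k ih =>
    have ih := ih fun j hj => hf j (hj.trans k.lt_succ_self)
    cases s with
    | inl s => exact ih s
    | inr s =>
      change f * (orderedMonomial e s * e k)
        = ((-s.sign : ℤˣ) : ℤ) • (orderedMonomial e s * e k * f)
      rw [← mul_assoc, ih s, smul_mul_assoc, mul_assoc, hf k k.lt_succ_self]
      simp [mul_assoc]

theorem orderedMonomial_neg (e : ℕ → A) {k : ℕ} (s : MonomialIndex k) :
    orderedMonomial (fun i => -e i) s = (s.sign : ℤ) • orderedMonomial e s := by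
  induction k with
  | zero => simp [orderedMonomial, MonomialIndex.sign]
  | succ k ih =>
    cases s with
    | inl s => exact ih s
    | inr s =>
      change orderedMonomial (fun i => -e i) s * (-e k)
        = ((-s.sign : ℤˣ) : ℤ) • (orderedMonomial e s * e k)
      rw [ih s]
      simp [mul_assoc]

variable [Invertible (2 : R)] {e : ℕ → A} {M : Matrix ℕ ℕ R}

theorem eq_algebraMap_half {u : A} {r : R} (h : u + u = algebraMap R A r) :
    u = algebraMap R A (⅟2 * r) := by
  rw [map_mul, ← h, ← two_mul, ← map_ofNat (algebraMap R A) 2, ← mul_assoc, ← map_mul,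
    invOf_mul_self, map_one, one_mul]

theorem monomialSpan_mul_mem (he : ∀ i j, e i * e j + e j * e i = algebraMap R A (M i j))
    {k j : ℕ} (hj : j < k) {u : A} (hu : u ∈ monomialSpan R e k) :
    u * e j ∈ monomialSpan R e k := by
  induction k generalizing u with
  | zero => omega
  | succ k ih =>
    induction hu using Submodule.span_induction with
    | zero => simp
    | add u v _ _ hu hv => rw [add_mul]; exact add_mem hu hv
    | smul r u _ hu => rw [smul_mul_assoc]; exact Submodule.smul_mem _ _ hu
    | mem u h =>
      obtain ⟨s, rfl⟩ := h
      have key : ∀ s : MonomialIndex k, orderedMonomial e s ∈ monomialSpan R e k :=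
        fun s => Submodule.subset_span ⟨s, rfl⟩
      have scal : ∀ (s : MonomialIndex k) (r : R),
          orderedMonomial e s * algebraMap R A r ∈ monomialSpan R e (k + 1) := fun s r => by
        rw [← Algebra.commutes, ← Algebra.smul_def]
        exact Submodule.smul_mem _ _ (monomialSpan_mono e k (key s))
      rcases (Nat.lt_succ_iff.1 hj).lt_or_eq with hj | rfl
      · cases s with
        | inl s => exact monomialSpan_mono e k (ih hj (key s))
        | inr s =>
          change orderedMonomial e s * e k * e j ∈ _
          rw [mul_assoc, eq_sub_of_add_eq (he k j), mul_sub, ← mul_assoc]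
          exact sub_mem (scal s _) (mul_mem_monomialSpan_succ e (ih hj (key s)))
      · cases s with
        | inl s => exact mul_mem_monomialSpan_succ e (key s)
        | inr s =>
          change orderedMonomial e s * e j * e j ∈ _
          rw [mul_assoc, eq_algebraMap_half (he j j)]
          exact scal s _

/-- The ordered monomials span the algebra as soon as the elements `e i` generate it. -/
theorem monomialSpan_eq_top (he : ∀ i j, e i * e j + e j * e i = algebraMap R A (M i j)) {k : ℕ}
    (hA : Algebra.adjoin R (e '' Set.Iio k) = ⊤) : monomialSpan R e k = ⊤ := by
  rw [eq_top_iff]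
  rintro v -
  have hv : v ∈ Algebra.adjoin R (e '' Set.Iio k) := hA ▸ Algebra.mem_top
  suffices h : ∀ u ∈ monomialSpan R e k, u * v ∈ monomialSpan R e k by
    simpa using h 1 (one_mem_monomialSpan e k)
  induction hv using Algebra.adjoin_induction with
  | mem v h => obtain ⟨j, hj, rfl⟩ := h; exact fun u hu => monomialSpan_mul_mem he hj hu
  | algebraMap r =>
    intro u hu
    rw [← Algebra.commutes, ← Algebra.smul_def]
    exact Submodule.smul_mem _ _ hu
  | add v w _ _ hv hw => intro u hu; rw [mul_add]; exact add_mem (hv u hu) (hw u hu)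
  | mul v w _ _ hv hw => intro u hu; rw [← mul_assoc]; exact hw _ (hv u hu)

end Ordered

/-! ### Gram determinants of ordered monomials -/

section Gram

variable {R A : Type*} [CommRing R] [Ring A] [Algebra R A]

/-- The Gram matrix of a family of elements for the bilinear form `(u, v) ↦ τ (u * v)`. -/
def gramMatrix (τ : A →ₗ[R] R) {ι : Type*} (v : ι → A) : Matrix ι ι R :=
  Matrix.of fun s t => τ (v s * v t)

theorem gramMatrix_of_eq_sum (τ : A →ₗ[R] R) {ι κ : Type*} [Fintype ι]
    (v : ι → A) (w : κ → A) (P : Matrix ι κ R) (h : ∀ j, w j = ∑ i, P i j • v i) :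
    gramMatrix τ w = Pᵀ * gramMatrix τ v * P := by
  ext s t
  simp only [gramMatrix, Matrix.of_apply, Matrix.mul_apply, Matrix.transpose_apply, h,
    Finset.sum_mul, Finset.mul_sum, map_sum, smul_mul_smul_comm, map_smul, smul_eq_mul]
  exact Finset.sum_congr rfl fun _ _ => Finset.sum_congr rfl fun _ _ => by ring

/-- The `k`-th leading principal minor. -/
def leadingMinor (M : Matrix ℕ ℕ R) (k : ℕ) : R :=
  (M.submatrix (Fin.val : Fin k → ℕ) Fin.val).det

/-- The combination of `e 0, …, e k` whose coefficients are the last column of the adjugate of the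
leading block of size `k + 1`: the Gram–Schmidt orthogonalization of `e k` against
`e 0, …, e (k - 1)`, cleared of denominators. -/
noncomputable def orthogonalized (M : Matrix ℕ ℕ R) (e : ℕ → A) (k : ℕ) : A :=
  ∑ j : Fin (k + 1),
    (M.submatrix (Fin.val : Fin (k + 1) → ℕ) Fin.val).adjugate j (Fin.last k) • e j

theorem adjugate_last_last (M : Matrix ℕ ℕ R) (k : ℕ) :
    (M.submatrix (Fin.val : Fin (k + 1) → ℕ) Fin.val).adjugate (Fin.last k) (Fin.last k)
      = leadingMinor M k := by
  rw [Matrix.adjugate_fin_succ_eq_det_submatrix, leadingMinor]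
  simp only [Fin.val_last, Fin.succAbove_last, Matrix.submatrix_submatrix]
  rw [Even.neg_one_pow ⟨k, rfl⟩, one_mul]
  rfl

variable {e : ℕ → A} {M : Matrix ℕ ℕ R}

theorem mul_orthogonalized_add (he : ∀ i j, e i * e j + e j * e i = algebraMap R A (M i j))
    {k : ℕ} (i : Fin (k + 1)) :
    e i * orthogonalized M e k + orthogonalized M e k * e i
      = algebraMap R A (if i = Fin.last k then leadingMinor M (k + 1) else 0) := by
  have h := congrFun₂ (Matrix.mul_adjugate
    (M.submatrix (Fin.val : Fin (k + 1) → ℕ) Fin.val)) i (Fin.last k)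
  rw [Matrix.mul_apply, Matrix.smul_apply, Matrix.one_apply, smul_eq_mul, mul_ite, mul_one,
    mul_zero] at h
  rw [leadingMinor, ← h, orthogonalized, Finset.mul_sum, Finset.sum_mul,
    ← Finset.sum_add_distrib, map_sum]
  refine Finset.sum_congr rfl fun j _ => ?_
  rw [mul_smul_comm, smul_mul_assoc, ← smul_add, he, mul_comm, map_mul, Algebra.smul_def]
  rfl

theorem orthogonalized_mul_eq_neg (he : ∀ i j, e i * e j + e j * e i = algebraMap R A (M i j))
    {k j : ℕ} (hj : j < k) :
    orthogonalized M e k * e j = -(e j * orthogonalized M e k) := by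
  have h := mul_orthogonalized_add he (⟨j, hj.trans k.lt_succ_self⟩ : Fin (k + 1))
  rw [if_neg (by simpa [Fin.ext_iff] using hj.ne), map_zero, add_comm] at h
  exact eq_neg_of_add_eq_zero_left h

theorem orthogonalized_sq_add (he : ∀ i j, e i * e j + e j * e i = algebraMap R A (M i j))
    (k : ℕ) :
    orthogonalized M e k * orthogonalized M e k + orthogonalized M e k * orthogonalized M e k
      = algebraMap R A (leadingMinor M k * leadingMinor M (k + 1)) := by
  set f := orthogonalized M e k with hf
  have h : ∀ w : A, (∑ j : Fin (k + 1),
      (M.submatrix (Fin.val : Fin (k + 1) → ℕ) Fin.val).adjugate j (Fin.last k) • e j) = w →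
      w * f + f * w = ∑ j : Fin (k + 1), (M.submatrix (Fin.val : Fin (k + 1) → ℕ)
        Fin.val).adjugate j (Fin.last k) • (e j * f + f * e j) := by
    rintro w rfl
    simp only [Finset.sum_mul, Finset.mul_sum, smul_add, Finset.sum_add_distrib, smul_mul_assoc,
      mul_smul_comm]
  -- in the expansion of the left factor `f`, only the term `e k` does not anticommute with `f`
  rw [h f hf.symm, Finset.sum_eq_single (Fin.last k)]
  · rw [mul_orthogonalized_add he, if_pos rfl, adjugate_last_last, map_mul, Algebra.smul_def]
  · intro j _ hj
    rw [mul_orthogonalized_add he, if_neg hj, map_zero, smul_zero]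
  · simp

theorem orthogonalized_eq_sum_add (k : ℕ) : ∃ c : Fin k → R,
    orthogonalized M e k = ∑ j : Fin k, c j • e j + leadingMinor M k • e k :=
  ⟨_, by rw [orthogonalized, Fin.sum_univ_castSucc, adjugate_last_last]; rfl⟩

variable {τ : A →ₗ[R] R} {α : A ≃ₐ[R] A}

theorem map_orthogonalized_neg (hαe : ∀ i, α (e i) = -e i) (k : ℕ) :
    α (orthogonalized M e k) = -orthogonalized M e k := by
  simp [orthogonalized, hαe]

theorem map_orderedMonomial_sign (hαe : ∀ i, α (e i) = -e i) {k : ℕ} (s : MonomialIndex k) :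
    α (orderedMonomial e s) = (s.sign : ℤ) • orderedMonomial e s := by
  rw [map_orderedMonomial α, funext hαe, orderedMonomial_neg]

variable [Invertible (2 : R)]

/-- A functional which is invariant under cyclic permutation and under the automorphism
`e i ↦ -e i` vanishes on a monomial times an odd element `f` anticommuting with its factors: the
product is odd when the monomial is even, and the two factors anticommute when it is odd. -/
theorem map_mul_eq_zero (hτ : ∀ u v, τ (u * v) = τ (v * u)) (hα : ∀ u, τ (α u) = τ u)
    {u f : A} {ε : ℤˣ} (hu : α u = (ε : ℤ) • u) (hf : α f = -f)
    (huf : f * u = (ε : ℤ) • (u * f)) : τ (u * f) = 0 := by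
  have h1 : τ (u * f) = (ε : ℤ) • τ (u * f) := by
    conv_lhs => rw [hτ, huf, map_zsmul]
  have h2 : τ (u * f) = -((ε : ℤ) • τ (u * f)) := by
    conv_lhs => rw [← hα, map_mul, hu, hf, smul_mul_assoc, mul_neg, smul_neg, map_neg, map_zsmul]
  rw [← h1] at h2
  have h3 : 2 * τ (u * f) = 0 := by linear_combination h2
  rw [← invOf_mul_cancel_left (2 : R) (τ (u * f)), h3, mul_zero]

/-- Passing from `k` to `k + 1` generators. The Gram matrix becomes block diagonal once the last
generator is replaced by `orthogonalized M e k`. -/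
theorem det_gramMatrix_succ (he : ∀ i j, e i * e j + e j * e i = algebraMap R A (M i j))
    (hτ : ∀ u v, τ (u * v) = τ (v * u)) (hα : ∀ u, τ (α u) = τ u) (hαe : ∀ i, α (e i) = -e i)
    (k : ℕ) : ∃ ε : ℤˣ,
      (leadingMinor M k ^ 2 ^ k) ^ 2 *
          (gramMatrix τ (orderedMonomial e : MonomialIndex (k + 1) → A)).det =
        (ε : ℤ) * (⅟2 * (leadingMinor M k * leadingMinor M (k + 1))) ^ 2 ^ k *
          (gramMatrix τ (orderedMonomial e : MonomialIndex k → A)).det ^ 2 := by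
  set f := orthogonalized M e k with hf
  set m : MonomialIndex k → A := orderedMonomial e
  set d := leadingMinor M k
  set q := ⅟2 * (d * leadingMinor M (k + 1))
  have hff : f * f = algebraMap R A q := eq_algebraMap_half (orthogonalized_sq_add he k)
  have hfm : ∀ s, f * m s = ((s.sign : ℤˣ) : ℤ) • (m s * f) :=
    mul_orderedMonomial e f fun j hj => orthogonalized_mul_eq_neg he hj
  have hzero : ∀ s t, τ (m s * m t * f) = 0 := fun s t => by
    refine map_mul_eq_zero (ε := s.sign * t.sign) hτ hα ?_ (map_orthogonalized_neg hαe k) ?_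
    · rw [map_mul, map_orderedMonomial_sign hαe, map_orderedMonomial_sign hαe,
        smul_mul_smul_comm, Units.val_mul]
    · rw [← mul_assoc, hfm, smul_mul_assoc, mul_assoc, hfm, mul_smul_comm, smul_smul,
        Units.val_mul, mul_assoc]
  obtain ⟨c, hc⟩ := orthogonalized_eq_sum_add (M := M) (e := e) k
  have hX : ∀ s, ∃ X : MonomialIndex k → R, ∑ t, X t • m t = m s * ∑ j : Fin k, c j • e j := by
    intro s
    refine (Submodule.mem_span_range_iff_exists_fun R).1 ?_
    rw [Finset.mul_sum]
    refine Submodule.sum_mem _ fun j _ => ?_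
    rw [mul_smul_comm]
    exact Submodule.smul_mem _ _ (monomialSpan_mul_mem he j.2 (Submodule.subset_span ⟨s, rfl⟩))
  choose X hX using hX
  -- `P` expresses `m s * f` through the monomials: `f` has leading coefficient `d` at `e k`, and
  -- the remaining terms stay in the span of the monomials in `k` generators
  let P : Matrix (MonomialIndex k ⊕ MonomialIndex k) (MonomialIndex k ⊕ MonomialIndex k) R :=
    Matrix.fromBlocks 1 (Matrix.of fun t s => X s t) 0 (d • 1)
  let v : MonomialIndex k ⊕ MonomialIndex k → A := Sum.elim m fun s => m s * e k
  have hv : gramMatrix τ (orderedMonomial e : MonomialIndex (k + 1) → A) = gramMatrix τ v := by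
    congr 1
    ext s
    cases s <;> rfl
  have h1 : gramMatrix τ (Sum.elim m fun s => m s * f) = Pᵀ * gramMatrix τ v * P := by
    refine gramMatrix_of_eq_sum τ _ _ P fun s => ?_
    cases s with
    | inl s => simp [P, v, Matrix.one_apply]
    | inr s =>
      simp [P, v, Matrix.one_apply, hX]
      rw [hf, hc, mul_add, mul_smul_comm]
  have h2 : gramMatrix τ (Sum.elim m fun s => m s * f) = Matrix.fromBlocks (gramMatrix τ m) 0 0
      (q • (gramMatrix τ m * Matrix.diagonal fun t => (((t.sign : ℤˣ) : ℤ) : R))) := by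
    ext s t
    rcases s with s | s <;> rcases t with t | t
    · simp [gramMatrix]
    · simp [gramMatrix, ← mul_assoc, hzero]
    · simp only [gramMatrix, of_apply, Sum.elim_inr, Sum.elim_inl, fromBlocks_apply₂₁,
        Matrix.zero_apply]
      rw [mul_assoc, hfm, mul_smul_comm, map_zsmul, ← mul_assoc, hzero, smul_zero]
    · simp only [of_apply, Sum.elim_inr, fromBlocks_apply₂₂, Matrix.smul_apply,
        mul_diagonal, smul_eq_mul, gramMatrix]
      rw [show m s * f * (m t * f) = m s * (f * m t) * f by simp only [mul_assoc], hfm,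
        mul_smul_comm, smul_mul_assoc, map_zsmul, mul_assoc, mul_assoc, hff, ← mul_assoc,
        ← Algebra.commutes, ← Algebra.smul_def, map_smul, zsmul_eq_mul, smul_eq_mul]
      ring
  have h3 := congrArg Matrix.det (h1.symm.trans h2)
  rw [Matrix.det_mul, Matrix.det_mul, Matrix.det_transpose, Matrix.det_fromBlocks_zero₂₁,
    Matrix.det_fromBlocks_zero₂₁, Matrix.det_smul, Matrix.det_smul, Matrix.det_mul,
    Matrix.det_diagonal, Matrix.det_one, MonomialIndex.card] at h3
  refine ⟨∏ t : MonomialIndex k, t.sign, ?_⟩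
  have h4 : (((∏ t : MonomialIndex k, t.sign : ℤˣ) : ℤ) : R)
      = ∏ t : MonomialIndex k, (((t.sign : ℤˣ) : ℤ) : R) := by
    simp
  have h5 : (gramMatrix τ (orderedMonomial e : MonomialIndex (k + 1) → A)).det
      = (gramMatrix τ v).det := congrArg Matrix.det hv
  rw [h4, h5]
  linear_combination h3

/-- The Gram determinant of the ordered monomials, up to sign and powers of `2`. -/
theorem det_gramMatrix_orderedMonomial [IsDomain R]
    (he : ∀ i j, e i * e j + e j * e i = algebraMap R A (M i j))
    (hτ : ∀ u v, τ (u * v) = τ (v * u)) (hα : ∀ u, τ (α u) = τ u) (hαe : ∀ i, α (e i) = -e i)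
    (k : ℕ) (hM : ∀ j < k, leadingMinor M j ≠ 0) : ∃ (p : ℕ) (ε : ℤˣ),
      (gramMatrix τ (orderedMonomial e : MonomialIndex k → A)).det =
        (ε : ℤ) * ⅟2 ^ p * τ 1 ^ 2 ^ k * leadingMinor M k ^ 2 ^ (k - 1) := by
  induction k with
  | zero =>
    refine ⟨0, 1, ?_⟩
    have : (gramMatrix τ (orderedMonomial e : MonomialIndex 0 → A)).det = τ (1 * 1) :=
      Matrix.det_unique (n := Unit) _
    simp [this, leadingMinor]
  | succ k ih =>
    obtain ⟨p, ε, h⟩ := ih fun j hj => hM j (hj.trans k.lt_succ_self)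
    obtain ⟨ε', h'⟩ := det_gramMatrix_succ he hτ hα hαe k
    -- for `k = 0` the truncated exponent `k - 1` is harmless, since the empty minor is `1`
    have hsq : (leadingMinor M k ^ 2 ^ (k - 1)) ^ 2 = leadingMinor M k ^ 2 ^ k := by
      cases k with
      | zero => simp [leadingMinor]
      | succ k => rw [Nat.add_sub_cancel, ← pow_mul, ← pow_succ]
    have hne : (leadingMinor M k ^ 2 ^ k) ^ 2 ≠ 0 := by
      have := hM k k.lt_succ_self
      positivity
    refine ⟨2 ^ k + p * 2, ε', mul_left_cancel₀ hne ?_⟩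
    have hε : ((ε : ℤ) : R) ^ 2 = 1 := by
      rw [← Int.cast_pow, ← Units.val_pow_eq_pow_val, Int.units_sq]; simp
    rw [h', h]
    simp only [mul_pow, hsq, hε, Nat.add_sub_cancel, pow_add, pow_mul, pow_succ 2 k]
    ring

end Gram

/-! ### Generators, universal property and sign automorphism of `VAlg a` -/

namespace VAlg

variable {T : Type*} [CommRing T] {n : ℕ} (a : Fin n → Fin n → T)

/-- The generators as a sequence indexed by `ℕ`, extended by zero. -/
noncomputable def xSeq (i : ℕ) : VAlg a :=
  if h : i < n then x a ⟨i, h⟩ else 0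

/-- The matrix `M₁`, extended by zero. -/
noncomputable def mSeq : Matrix ℕ ℕ (Z a) :=
  Matrix.of fun i j => if h : i < n ∧ j < n then M₁ a ⟨i, h.1⟩ ⟨j, h.2⟩ else 0

variable {a} in
theorem algHom_ext {B : Type*} [Ring B] [Algebra T B] {f g : VAlg a →ₐ[T] B}
    (h : ∀ i, f (x a i) = g (x a i)) : f = g :=
  RingQuot.ringQuot_ext' (S := T) (s := Rel a) f g (FreeAlgebra.hom_ext (funext h))

variable {a} in
/-- The universal property of `VAlg a`. -/
noncomputable def lift {B : Type*} [Ring B] [Algebra T B] (e : Fin n → B)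
    (he : ∀ i j, i ≠ j → e i * e j + e j * e i = algebraMap T B (a i j)) : VAlg a →ₐ[T] B :=
  RingQuot.liftAlgHom T ⟨FreeAlgebra.lift T e, by
    rintro _ _ ⟨i, j, h⟩
    simp [he i j h]⟩

variable {a} in
@[simp]
theorem lift_x {B : Type*} [Ring B] [Algebra T B] (e : Fin n → B)
    (he : ∀ i j, i ≠ j → e i * e j + e j * e i = algebraMap T B (a i j)) (i : Fin n) :
    lift e he (x a i) = e i :=
  (RingQuot.liftAlgHom_mkAlgHom_apply T _ _ _).trans (FreeAlgebra.lift_ι_apply _ _)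

theorem xSeq_mul_add (i j : ℕ) :
    xSeq a i * xSeq a j + xSeq a j * xSeq a i = algebraMap (Z a) (VAlg a) (mSeq a i j) := by
  by_cases hi : i < n
  · by_cases hj : j < n
    · simp only [xSeq, hi, hj, mSeq, M₁, dif_pos, Matrix.of_apply, and_self]
      split_ifs with h
      · obtain rfl : i = j := by simpa using h
        rw [two_mul, map_add]
        change _ = x a _ ^ 2 + x a _ ^ 2
        rw [sq]
      · exact x_mul_x_add a _ _ h
    · simp [xSeq, mSeq, hj]
  · simp [xSeq, mSeq, hi]

theorem leadingMinor_mSeq : leadingMinor (mSeq a) n = (M₁ a).det := by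
  rw [leadingMinor]
  congr 1
  ext i j
  simp [mSeq]

theorem adjoin_xSeq : Algebra.adjoin (Z a) (xSeq a '' Set.Iio n) = ⊤ := by
  rw [eq_top_iff]
  rintro v -
  obtain ⟨f, rfl⟩ := RingQuot.mkAlgHom_surjective T (Rel a) v
  induction f using FreeAlgebra.induction with
  | grade0 r =>
    rw [AlgHom.commutes]
    exact Subalgebra.algebraMap_mem _ (algebraMap T (Z a) r)
  | grade1 i =>
    exact Algebra.subset_adjoin ⟨i, i.2, by rw [xSeq, dif_pos i.2]; rfl⟩
  | mul f g hf hg => rw [map_mul]; exact mul_mem hf hg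
  | add f g hf hg => rw [map_add]; exact add_mem hf hg

theorem span_orderedMonomial [Invertible (2 : Z a)] :
    ⊤ ≤ Submodule.span (Z a) (Set.range (orderedMonomial (xSeq a) : MonomialIndex n → VAlg a)) :=
  (monomialSpan_eq_top (xSeq_mul_add a) (adjoin_xSeq a)).ge

/-- The automorphism `x i ↦ -x i`, over `T`. -/
noncomputable def negHom : VAlg a →ₐ[T] VAlg a :=
  lift (fun i => -x a i) fun i j h => by simpa using x_mul_x_add a i j h

theorem negHom_of_mem {z : VAlg a} (hz : z ∈ Z a) : negHom a z = z := by
  induction hz using Algebra.adjoin_induction with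
  | mem v h => obtain ⟨i, rfl⟩ := h; simp [negHom]
  | algebraMap r => exact AlgHom.commutes _ r
  | add v w _ _ hv hw => rw [map_add, hv, hw]
  | mul v w _ _ hv hw => rw [map_mul, hv, hw]

theorem negHom_negHom (v : VAlg a) : negHom a (negHom a v) = v :=
  DFunLike.congr_fun (f := (negHom a).comp (negHom a)) (g := AlgHom.id T _)
    (algHom_ext fun i => by simp [negHom]) v

/-- The automorphism `x i ↦ -x i` of the `Z`-algebra `VAlg a`. -/
noncomputable def negEquiv : VAlg a ≃ₐ[Z a] VAlg a :=
  AlgEquiv.ofRingEquiv (f := RingEquiv.ofRingHom (negHom a).toRingHom (negHom a).toRingHom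
    (RingHom.ext (negHom_negHom a)) (RingHom.ext (negHom_negHom a)))
    fun z => negHom_of_mem a z.2

theorem negEquiv_xSeq (i : ℕ) : negEquiv a (xSeq a i) = -xSeq a i := by
  change negHom a (xSeq a i) = _
  rw [xSeq]
  split_ifs <;> simp [negHom]

/-- The polynomial ring in the squares of the generators maps onto `Z`. -/
noncomputable def polyHom : MvPolynomial (Fin n) T →ₐ[T] Z a :=
  MvPolynomial.aeval (xSq a)

theorem polyHom_surjective : Function.Surjective (polyHom a) := by
  rintro ⟨z, hz⟩
  suffices h : ∃ p, (polyHom a p : VAlg a) = z from h.imp fun p hp => Subtype.ext hp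
  induction hz using Algebra.adjoin_induction with
  | mem v h => obtain ⟨i, rfl⟩ := h; exact ⟨MvPolynomial.X i, by simp [polyHom, xSq]⟩
  | algebraMap r => exact ⟨MvPolynomial.C r, by simp [polyHom]⟩
  | add v w _ _ hv hw =>
    obtain ⟨p, rfl⟩ := hv
    obtain ⟨q, rfl⟩ := hw
    exact ⟨p + q, by rw [map_add]; rfl⟩
  | mul v w _ _ hv hw =>
    obtain ⟨p, rfl⟩ := hv
    obtain ⟨q, rfl⟩ := hw
    exact ⟨p * q, by rw [map_mul]; rfl⟩

/-! ### Comparison with a Clifford algebra over a polynomial ring -/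

section Clifford

variable [Invertible (2 : MvPolynomial (Fin n) T)]

/-- The quadratic form over the polynomial ring `T[X 0, …, X (n - 1)]` with values `X i` on the
standard basis and polar form `a i j`; half of the latter goes to each of the entries `(i, j)` and
`(j, i)` of the matrix. -/
noncomputable def form : QuadraticForm (MvPolynomial (Fin n) T) (Fin n → MvPolynomial (Fin n) T) :=
  LinearMap.BilinMap.toQuadraticMap (Matrix.toBilin' (Matrix.of fun i j =>
    if i = j then MvPolynomial.X i else ⅟2 * MvPolynomial.C (a i j)))

theorem form_single (i : Fin n) : form a (Pi.single i 1) = MvPolynomial.X i := by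
  simp [form]

theorem polar_form_single (ha : ∀ i j, i < j → a j i = a i j) {i j : Fin n} (h : i ≠ j) :
    QuadraticMap.polar (form a) (Pi.single i 1) (Pi.single j 1) = MvPolynomial.C (a i j) := by
  have hs : a j i = a i j := by
    rcases lt_or_gt_of_ne h with h | h
    · exact ha i j h
    · exact (ha j i h).symm
  rw [form, LinearMap.BilinMap.polar_toQuadraticMap]
  simp [h, h.symm, hs, ← two_mul]

/-- The comparison map to the Clifford algebra of `form a`. -/
noncomputable def toClifford (ha : ∀ i j, i < j → a j i = a i j) :
    VAlg a →ₐ[T] CliffordAlgebra (form a) :=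
  lift (fun i => CliffordAlgebra.ι (form a) (Pi.single i 1)) fun i j h => by
    rw [CliffordAlgebra.ι_mul_ι_add_swap, polar_form_single a ha h]
    exact (IsScalarTower.algebraMap_apply T (MvPolynomial (Fin n) T) _ (a i j)).symm

theorem toClifford_polyHom (ha : ∀ i j, i < j → a j i = a i j) (p : MvPolynomial (Fin n) T) :
    toClifford a ha (polyHom a p) = algebraMap _ _ p := by
  have : ((toClifford a ha).comp (Z a).val).comp (polyHom a)
      = Algebra.algHom T (MvPolynomial (Fin n) T) (CliffordAlgebra (form a)) := by
    refine MvPolynomial.algHom_ext fun i => ?_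
    change toClifford a ha (polyHom a (MvPolynomial.X i)) = _
    have h : (polyHom a (MvPolynomial.X i) : VAlg a) = x a i ^ 2 := by simp [polyHom, xSq]
    rw [h, map_pow, toClifford, lift_x, sq, CliffordAlgebra.ι_sq_scalar, form_single]
    rfl
  exact DFunLike.congr_fun this p

/-- The standard basis vectors as a sequence indexed by `ℕ`, extended by zero. -/
noncomputable def vecSeq (T : Type*) [CommRing T] (n i : ℕ) : Fin n → MvPolynomial (Fin n) T :=
  if h : i < n then Pi.single ⟨i, h⟩ 1 else 0

theorem toClifford_orderedMonomial (ha : ∀ i j, i < j → a j i = a i j) (s : MonomialIndex n) :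
    toClifford a ha (orderedMonomial (xSeq a) s)
      = orderedMonomial (fun i => CliffordAlgebra.ι (form a) (vecSeq T n i)) s := by
  rw [map_orderedMonomial]
  congr 1
  ext i
  rw [xSeq, vecSeq]
  split_ifs <;> simp [toClifford]

theorem span_orderedMonomial_ι :
    ⊤ ≤ Submodule.span (MvPolynomial (Fin n) T) (Set.range (orderedMonomial
      (fun i => CliffordAlgebra.ι (form a) (vecSeq T n i)) :
        MonomialIndex n → CliffordAlgebra (form a))) := by
  refine (monomialSpan_eq_top
    (M := Matrix.of fun i j => QuadraticMap.polar (form a) (vecSeq T n i) (vecSeq T n j))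
    (fun i j => CliffordAlgebra.ι_mul_ι_add_swap _ _) ?_).ge
  rw [eq_top_iff, ← CliffordAlgebra.adjoin_range_ι]
  refine Algebra.adjoin_le ?_
  rintro _ ⟨v, rfl⟩
  rw [← (Pi.basisFun (MvPolynomial (Fin n) T) (Fin n)).sum_repr v, map_sum]
  refine sum_mem fun i _ => ?_
  have h : CliffordAlgebra.ι (form a) (vecSeq T n i) ∈ Algebra.adjoin (MvPolynomial (Fin n) T)
      ((fun i => CliffordAlgebra.ι (form a) (vecSeq T n i)) '' Set.Iio n) :=
    Algebra.subset_adjoin ⟨i, i.2, rfl⟩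
  rw [vecSeq, dif_pos i.2] at h
  rw [map_smul, Pi.basisFun_apply]
  exact Subalgebra.smul_mem _ h _

/-- The ordered monomials form a basis of the Clifford algebra: they span it, and their number is
its rank, by comparison with the exterior algebra. -/
noncomputable def cliffordBasis [Nontrivial T] :
    Module.Basis (MonomialIndex n) (MvPolynomial (Fin n) T) (CliffordAlgebra (form a)) :=
  basisOfTopLeSpanOfCardEqFinrank _ (span_orderedMonomial_ι a) (by
    rw [(CliffordAlgebra.equivExterior (form a)).finrank_eq, MonomialIndex.card,
      Module.finrank_eq_card_basis
        (Pi.basisFun (MvPolynomial (Fin n) T) (Fin n)).ExteriorAlgebra,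
      Fintype.card_finset, Fintype.card_fin])

theorem polyHom_injective [Nontrivial T] (ha : ∀ i j, i < j → a j i = a i j) :
    Function.Injective (polyHom a) := by
  have : Module.Free (MvPolynomial (Fin n) T) (CliffordAlgebra (form a)) :=
    Module.Free.of_basis (cliffordBasis a)
  intro p q h
  apply FaithfulSMul.algebraMap_injective (MvPolynomial (Fin n) T) (CliffordAlgebra (form a))
  rw [← toClifford_polyHom a ha, ← toClifford_polyHom a ha, h]

/-- The central subalgebra `Z` is a polynomial ring. -/
noncomputable def polyEquiv [Nontrivial T] (ha : ∀ i j, i < j → a j i = a i j) :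
    MvPolynomial (Fin n) T ≃ₐ[T] Z a :=
  AlgEquiv.ofBijective (polyHom a) ⟨polyHom_injective a ha, polyHom_surjective a⟩

theorem linearIndependent_orderedMonomial [Nontrivial T] (ha : ∀ i j, i < j → a j i = a i j) :
    LinearIndependent (Z a) (orderedMonomial (xSeq a) : MonomialIndex n → VAlg a) := by
  refine Fintype.linearIndependent_iff.2 fun z hz => ?_
  choose p hp using fun s => polyHom_surjective a (z s)
  have h : ∑ s : MonomialIndex n, p s • cliffordBasis a s = 0 := by
    rw [← map_zero (toClifford a ha), ← hz, map_sum]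
    refine Finset.sum_congr rfl fun s _ => ?_
    change p s • cliffordBasis a s
      = toClifford a ha ((z s : VAlg a) * orderedMonomial (xSeq a) s)
    rw [Algebra.smul_def, ← toClifford_polyHom a ha, hp, cliffordBasis,
      coe_basisOfTopLeSpanOfCardEqFinrank, ← toClifford_orderedMonomial a ha, ← map_mul]
  intro s
  rw [← hp, Fintype.linearIndependent_iff.1 (cliffordBasis a).linearIndependent p h s, map_zero]

end Clifford

/-- The basis of `VAlg a` over `Z` given by the ordered monomials. -/
noncomputable def monomialBasis [Nontrivial T] [Invertible (2 : Z a)]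
    [Invertible (2 : MvPolynomial (Fin n) T)] (ha : ∀ i j, i < j → a j i = a i j) :
    Module.Basis (MonomialIndex n) (Z a) (VAlg a) :=
  Module.Basis.mk (linearIndependent_orderedMonomial a ha) (span_orderedMonomial a)

/-- The substitution `X i ↦ X / 2` turns the leading blocks of `M₁` into matrices `X + A` with
`A` constant, whose determinants are monic. -/
theorem leadingMinor_mSeq_ne_zero [Nontrivial T] [Invertible (2 : T)]
    [Invertible (2 : MvPolynomial (Fin n) T)] (ha : ∀ i j, i < j → a j i = a i j) {k : ℕ}
    (hk : k ≤ n) : leadingMinor (mSeq a) k ≠ 0 := by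
  intro h0
  let φ : Z a →ₐ[T] Polynomial T :=
    (MvPolynomial.aeval fun _ : Fin n => Polynomial.C ⅟(2 : T) * Polynomial.X).comp
      (polyEquiv a ha).symm.toAlgHom
  have hφ : ∀ i, φ (xSq a i) = Polynomial.C ⅟(2 : T) * Polynomial.X := by
    intro i
    have : xSq a i = polyEquiv a ha (MvPolynomial.X i) := by simp [polyEquiv, polyHom]
    simp [φ, this]
  have h : φ (leadingMinor (mSeq a) k)
      = ((Polynomial.X : Polynomial T) • (1 : Matrix (Fin k) (Fin k) (Polynomial T))
        + (Matrix.of fun i j : Fin k => if i = j then 0 else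
          a (Fin.castLE hk i) (Fin.castLE hk j)).map Polynomial.C).det := by
    rw [leadingMinor, AlgHom.map_det]
    congr 1
    ext1 i j
    have hi : (i : ℕ) < n := i.2.trans_le hk
    have hj : (j : ℕ) < n := j.2.trans_le hk
    by_cases hij : i = j
    · subst hij
      have : (2 : Polynomial T) * (Polynomial.C ⅟2 * Polynomial.X) = Polynomial.X := by
        rw [← mul_assoc, ← map_ofNat Polynomial.C 2, ← map_mul, mul_invOf_self, map_one, one_mul]
      have hφ2 : φ 2 = 2 := map_ofNat φ 2
      simp [mSeq, M₁, hi, hφ, hφ2, this]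
    · simp [mSeq, M₁, hi, hj, hij, Fin.val_inj]
      rfl
  have h1 := Polynomial.leadingCoeff_det_X_one_add_C (Matrix.of fun i j : Fin k =>
    if i = j then 0 else a (Fin.castLE hk i) (Fin.castLE hk j))
  rw [← h, h0, map_zero, Polynomial.leadingCoeff_zero] at h1
  exact zero_ne_one h1

end VAlg

/-! ### Traces of left multiplications and change of basis -/

section Discriminant

variable (R A : Type*) [CommRing R] [Ring A] [Algebra R A]

/-- The trace of left multiplication, as a linear functional. -/
noncomputable def mulLeftTrace : A →ₗ[R] R :=
  LinearMap.trace R A ∘ₗ LinearMap.mul R A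

variable {R A}

theorem mulLeftTrace_mul_comm (u v : A) :
    mulLeftTrace R A (u * v) = mulLeftTrace R A (v * u) := by
  change LinearMap.trace R A (LinearMap.mulLeft R (u * v))
    = LinearMap.trace R A (LinearMap.mulLeft R (v * u))
  rw [LinearMap.mulLeft_mul, LinearMap.mulLeft_mul]
  exact LinearMap.trace_mul_comm R _ _

theorem mulLeftTrace_algEquiv (α : A ≃ₐ[R] A) (u : A) :
    mulLeftTrace R A (α u) = mulLeftTrace R A u := by
  refine Eq.trans ?_ (LinearMap.trace_conj' (LinearMap.mulLeft R u) α.toLinearEquiv)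
  change LinearMap.trace R A (LinearMap.mulLeft R (α u)) = _
  congr 1
  ext v
  simp [LinearEquiv.conj_apply]

theorem mulLeftTrace_one [Nontrivial R] [Module.Free R A] [Module.Finite R A] :
    mulLeftTrace R A 1 = Module.finrank R A := by
  rw [← LinearMap.trace_one]
  change LinearMap.trace R A (LinearMap.mulLeft R 1) = _
  rw [LinearMap.mulLeft_one]
  rfl

theorem discriminant_eq_det_gramMatrix {ι : Type*} [Fintype ι] [DecidableEq ι]
    (b : Module.Basis ι R A) : discriminant b = (gramMatrix (mulLeftTrace R A) b).det :=
  rfl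

/-- The discriminant does not depend on the basis, up to units. -/
theorem exists_discriminant_eq_units_mul [Nontrivial R] {ι κ : Type*} [Fintype ι] [DecidableEq ι]
    [Fintype κ] [DecidableEq κ] (b : Module.Basis ι R A) (c : Module.Basis κ R A) :
    ∃ u : Rˣ, discriminant c = u * discriminant b := by
  let b' := b.reindex (b.indexEquiv c)
  have h1 : discriminant b' = discriminant b := by
    rw [discriminant_eq_det_gramMatrix, discriminant_eq_det_gramMatrix,
      ← Matrix.det_submatrix_equiv_self (b.indexEquiv c).symm (gramMatrix _ b)]
    congr 1
    ext i j
    simp [gramMatrix, b']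
  have h2 : gramMatrix (mulLeftTrace R A) c
      = (b'.toMatrix c)ᵀ * gramMatrix (mulLeftTrace R A) b' * b'.toMatrix c :=
    gramMatrix_of_eq_sum _ _ _ _ fun j => (b'.sum_toMatrix_smul_self c j).symm
  obtain ⟨u, hu⟩ : IsUnit (b'.toMatrix c).det := by
    rw [← Module.Basis.det_apply]; exact b'.isUnit_det c
  refine ⟨u * u, ?_⟩
  rw [discriminant_eq_det_gramMatrix, h2, Matrix.det_mul, Matrix.det_mul, Matrix.det_transpose,
    ← hu, ← discriminant_eq_det_gramMatrix, h1, Units.val_mul]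
  ring

end Discriminant

/-! ### The discriminant of `VAlg a` over `Z` -/

namespace VAlg

variable {T : Type*} [CommRing T] [IsDomain T] {n : ℕ} (a : Fin n → Fin n → T)

/-- The units of the polynomial ring `Z` are constants. -/
theorem exists_units_eq_algebraMap [Invertible (2 : MvPolynomial (Fin n) T)]
    (ha : ∀ i j, i < j → a j i = a i j) {z : Z a} (hz : IsUnit z) :
    ∃ c : Tˣ, z = algebraMap T (Z a) c := by
  obtain ⟨_, ⟨c, rfl⟩, hc⟩ :=
    MvPolynomial.isUnit_iff_eq_C_of_isReduced.1 (hz.map (polyEquiv a ha).symm)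
  refine ⟨c, ?_⟩
  rw [← (polyEquiv a ha).commutes, MvPolynomial.algebraMap_eq, ← hc, AlgEquiv.apply_symm_apply]

/-- The discriminant formula for a general `VAlg a`. All constants that occur, from the change of
basis and from the powers of `2`, are units of `Z`, hence units of `T`. -/
theorem finite_free_discriminant (h2 : IsUnit (2 : T)) (ha : ∀ i j, i < j → a j i = a i j) :
    Module.Finite (Z a) (VAlg a) ∧ Module.Free (Z a) (VAlg a) ∧
      ∀ {ι : Type*} [Fintype ι] [DecidableEq ι] (b : Module.Basis ι (Z a) (VAlg a)),
        ∃ c : Tˣ, discriminant b = algebraMap T (Z a) c * (M₁ a).det ^ 2 ^ (n - 1) := by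
  let _ : Invertible (2 : T) := h2.invertible
  have h2P : IsUnit (2 : MvPolynomial (Fin n) T) := by
    have h := h2.map (algebraMap T (MvPolynomial (Fin n) T))
    rwa [map_ofNat] at h
  let _ : Invertible (2 : MvPolynomial (Fin n) T) := h2P.invertible
  have h2Z : IsUnit (2 : Z a) := by
    have h := h2.map (algebraMap T (Z a))
    rwa [map_ofNat] at h
  let _ : Invertible (2 : Z a) := h2Z.invertible
  have : IsDomain (Z a) := (polyEquiv a ha).toMulEquiv.isDomain_iff.1 inferInstance
  let m := monomialBasis a ha
  have hfin : Module.Finite (Z a) (VAlg a) := Module.Finite.of_basis m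
  have hfree : Module.Free (Z a) (VAlg a) := Module.Free.of_basis m
  refine ⟨hfin, hfree, fun b => ?_⟩
  obtain ⟨u, hu⟩ := exists_discriminant_eq_units_mul m b
  obtain ⟨p, ε, h⟩ := det_gramMatrix_orderedMonomial (xSeq_mul_add a)
    (mulLeftTrace_mul_comm (R := Z a)) (mulLeftTrace_algEquiv (negEquiv a)) (negEquiv_xSeq a) n
    fun j hj => leadingMinor_mSeq_ne_zero a ha hj.le
  have h1 : mulLeftTrace (Z a) (VAlg a) 1 = 2 ^ n := by
    rw [mulLeftTrace_one, Module.finrank_eq_card_basis m, MonomialIndex.card]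
    push_cast
    rfl
  have hm : (m : MonomialIndex n → VAlg a) = orderedMonomial (xSeq a) := Module.Basis.coe_mk _ _
  have hunit : IsUnit ((u : Z a) * (((ε : ℤ) : Z a) * ⅟2 ^ p * (2 ^ n) ^ 2 ^ n)) :=
    u.isUnit.mul (((ε.isUnit.map (Int.castRingHom (Z a))).mul ((isUnit_of_invertible _).pow p)).mul
      ((h2Z.pow n).pow _))
  obtain ⟨c, hc⟩ := exists_units_eq_algebraMap a ha hunit
  refine ⟨c, ?_⟩
  rw [hu, discriminant_eq_det_gramMatrix m, hm, h, h1, leadingMinor_mSeq, ← hc]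
  ring

end VAlg

theorem theorem3p6 {T : Type*} [CommRing T] [IsDomain T] (h2 : IsUnit (2 : T))
    (n : ℕ) (hn : 2 ≤ n) :
    (∀ a : Fin n → Fin n → T, (∀ i j, i < j → a j i = a i j) →
      Module.Finite (VAlg.Z a) (VAlg a) ∧ Module.Free (VAlg.Z a) (VAlg a) ∧
      ∀ {ι : Type*} [Fintype ι] [DecidableEq ι] (b : Module.Basis ι (VAlg.Z a) (VAlg a)),
        ∃ c : Tˣ, discriminant b =
          algebraMap T (VAlg.Z a) c * (VAlg.M₁ a).det ^ 2 ^ (n - 1)) ∧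
    (Module.Finite (WAlg.Z T n) (WAlg T n) ∧ Module.Free (WAlg.Z T n) (WAlg T n) ∧
      ∀ {ι : Type*} [Fintype ι] [DecidableEq ι] (b : Module.Basis ι (WAlg.Z T n) (WAlg T n)),
        ∃ c : Tˣ, discriminant b =
          algebraMap T (WAlg.Z T n) c * (WAlg.M T n).det ^ 2 ^ (n - 1)) := by
  refine ⟨fun a ha => VAlg.finite_free_discriminant a h2 ha, ?_⟩
  have hM : WAlg.M T n = VAlg.M₁ (fun _ _ : Fin n => (1 : T)) := by
    ext1 i j
    simp only [WAlg.M, VAlg.M₁, map_one]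
  rw [hM]
  exact VAlg.finite_free_discriminant (fun _ _ : Fin n => (1 : T)) h2 fun _ _ _ => rfl
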